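/- Let $K$ be a field, $n\ge 0$, and $P=K[x_1,\dots,x_n]$. For a maximal ideal $\mathfrak M$ of $P$ and an ideal $J$ of $P_{\mathfrak M}$, the ring $P_{\mathfrak M}/J$ is called a complete intersection if $J$ is generated by a regular sequence of length $n$ in $P_{\mathfrak M}$. For an ideal $I\subseteq P$ with $\dim_K P/I<\infty$, the scheme $\mathbb X=\operatorname{Spec}(P/I)$ is called locally a complete intersection if for each maximal ideal $\mathfrak m$ of $P/I$, with preimage $\mathfrak M$ in $P$, the local ring $(P/I)_{\mathfrak m}$, presented as the quotient of $P_{\mathfrak M}$ by the kernel of the canonical surjection $P_{\mathfrak M}\to(P/I)_{\mathfrak m}$, is a complete intersection. (1) Let $\mathfrak M\subset P$ be a maximal ideal, let $(g_1,\dots,g_n)$ be a regular sequence in $P$ which generates $\mathfrak M$, let $\mathfrak Q$ be an $\mathfrak M$-primary ideal, and let $f_1,\dots,f_r$ generate $\mathfrak Q$. Then there is a matrix $W=(a_{kj})\in\operatorname{Mat}_{n,r}(P)$ such that $f_j=\sum_{k=1}^n a_{kj}g_k$ for $j=1,\dots,r$. For every such matrix $W$, the following are equivalent: (a) the ideal $\mathfrak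 Q P_{\mathfrak M}$ is generated by a regular sequence in $P_{\mathfrak M}$; (b) the ring $P_{\mathfrak M}/\mathfrak Q P_{\mathfrak M}\cong P/\mathfrak Q$ is a complete intersection; (c) some minor of order $n$ of $W$ has a non-zero residue class in $P/\mathfrak Q$. (2) Let $I\subseteq P$ be an ideal with $\dim_K P/I<\infty$, and let $\mathbb X=\operatorname{Spec}(P/I)$. Then $I$ has a minimal primary decomposition. Let $I=\mathfrak Q_1\cap\dots\cap\mathfrak Q_s$ be any minimal primary decomposition. Each $\mathfrak M_i=\operatorname{Rad}(\mathfrak Q_i)$ is a maximal ideal which is generated by a regular sequence of length $n$ in $P$, and each $\mathfrak Q_i$ is finitely generated. For any choice, for each $i$, of a regular sequence of length $n$ generating $\mathfrak M_i$, of a finite system of generators of $\mathfrak Q_i$, and of a matrix $W_i$ expressing these generators through the regular sequence as in (1), the scheme $\mathbb X$ is locally a complete intersection if and only if, for every $i\in\{1,\dots,s\}$, some minor of order $n$ of $W_i$ has a non-zero residue class in $P/\mathfrak Q_i$. -/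

import Mathlib

/-- `J` is generated by some regular sequence (of any length) in `A`. -/
def Ideal.GeneratedByRegularSequence {A : Type*} [CommRing A] (J : Ideal A) : Prop :=
  ∃ hs : List A, RingTheory.Sequence.IsRegular A hs ∧ Ideal.ofList hs = J

section

variable {K : Type*} [Field K] {n : ℕ}

/-- For `P = K[x₁, …, xₙ]`, a prime ideal `M` of `P` and an ideal `J` of the localization `P_M`:
the local ring `P_M / J` is a complete intersection, i.e. `J` is generated by a regular sequence
of length `n` in `P_M`. -/
def IsCompleteIntersectionQuotient (M : Ideal (MvPolynomial (Fin n) K)) [M.IsPrime]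
    (J : Ideal (Localization.AtPrime M)) : Prop :=
  ∃ hs : List (Localization.AtPrime M), hs.length = n ∧
    RingTheory.Sequence.IsRegular (Localization.AtPrime M) hs ∧ Ideal.ofList hs = J

/-- The scheme `Spec (P / I)` is a complete intersection at the prime ideal `m` of `P / I`:
with `M` the preimage of `m` in `P`, the local ring `(P / I)_m` is a complete intersection, where
it is presented as the quotient of `P_M` by the kernel of the canonical surjection
`P_M → (P / I)_m`. -/
def IsCompleteIntersectionAt (I : Ideal (MvPolynomial (Fin n) K))
    (m : Ideal (MvPolynomial (Fin n) K ⧸ I)) [m.IsPrime] : Prop :=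
  IsCompleteIntersectionQuotient (m.comap (Ideal.Quotient.mk I))
    (RingHom.ker
      (Localization.localRingHom (m.comap (Ideal.Quotient.mk I)) m (Ideal.Quotient.mk I) rfl))

/-- The scheme `Spec (P / I)` is locally a complete intersection: it is a complete intersection
at every maximal ideal of `P / I`. -/
def IsLocallyCompleteIntersection (I : Ideal (MvPolynomial (Fin n) K)) : Prop :=
  ∀ (m : Ideal (MvPolynomial (Fin n) K ⧸ I)) [m.IsMaximal], IsCompleteIntersectionAt I m

/-- The `n × r` matrix `W` expresses `f₁, …, f_r` through `g₁, …, gₙ`: its `j`-th column consists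
of coefficients `a_{kj}` with `f_j = ∑ₖ a_{kj} gₖ`. -/
def IsCoefficientMatrix {r : ℕ} (g : Fin n → MvPolynomial (Fin n) K)
    (f : Fin r → MvPolynomial (Fin n) K)
    (W : Matrix (Fin n) (Fin r) (MvPolynomial (Fin n) K)) : Prop :=
  ∀ j, f j = ∑ k, W k j * g k

/-- The Boolean outcome `TRUE` of the check: some minor of order `n` of `W` (given by columns
`c 0 < c 1 < ⋯`) has a non-zero residue class in `P / Q`. -/
def CheckReturnsTrue {r : ℕ} (Q : Ideal (MvPolynomial (Fin n) K))
    (W : Matrix (Fin n) (Fin r) (MvPolynomial (Fin n) K)) : Prop :=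
  ∃ c : Fin n ↪o Fin r, Ideal.Quotient.mk Q (W.submatrix id c).det ≠ 0

end

/-!
The heart of the matter is a statement about a noetherian local ring `R` whose maximal ideal `𝔪` is
generated by a regular sequence `g = (g₁, …, gₙ)`, an `𝔪`-primary ideal `q ⊆ 𝔪` and generators
`f = Wᵀ g` of `q`.

*Exchange.* Two regular sequences of the same length on a finitely generated module have quotients
with isomorphic socles (`IsWeaklyRegular.nonempty_socle_equiv`). Hence a quotient by a regular
sequence shorter than `n` has zero socle, that is, positive depth, and a quotient by a regular
sequence of length `n` has a socle isomorphic to that of `R / 𝔪`, so a simple one. In particular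
each regular sequence that generates an `𝔪`-primary ideal has length `n`.

*Determinants.* If `h = A g` and `(h)` is `𝔪`-primary, then `det A ∉ (h)`
(`IsLocalRing.det_notMem_span`). To see this, write high powers `g ^ (N + 1)` as `B h`. The
matrices `B A` and `diag (g ^ N)` both express `g ^ (N + 1)` through `g`, so their determinants
agree modulo `(g ^ (N + 1))`. By Cramer's rule `det B` multiplies `(h)` into `(g ^ (N + 1))`,
whereas the product of the `gᵢ ^ N` does not lie in that ideal.

*Regular sequence to minor.* If `q = (h)` for a regular sequence `h`, write `h = B f = (B Wᵀ) g`.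
Expanding `det (B Wᵀ) ∉ q` multilinearly exhibits a maximal minor of `W` outside `q`.

*Minor to regular sequence.* If a maximal minor of `W`, belonging to the columns that express `f_c`,
lies outside `q`, then prime avoidance in cosets provides a regular sequence `h ≡ f_c` modulo `q 𝔪`.
Its transition matrix has the same determinant `Δ` modulo `q`. The ideal `(h)` is `𝔪`-primary by the
dimension formula. If `(h) ≠ q`, then `q / (h)` meets the simple socle of `R / (h)`, which contains
the nonzero class of `Δ`, so `Δ ∈ q`, a contradiction
(`IsLocalRing.exists_isWeaklyRegular_span_eq`).

A primary ideal is recovered from its extension to the localization at its radical, which carries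
the equivalence over to polynomial rings. The maximal ideals of `K[x₁, …, xₙ]` are generated by
regular sequences by induction on `n`: over a Jacobson ring `A`, a maximal ideal of `A[X]` contracts
to a maximal ideal of `A` and is generated by this contraction and one monic polynomial. Finally,
for a zero-dimensional `I` the kernel of `P_M → (P / I)_m` is generated by the primary component of
`I` with radical `M`, so the global statement follows one component at a time.
-/

section Auxiliary

open RingTheory.Sequence IsLocalRing Submodule
open scoped Pointwise

/-! ### Socles and exchange of regular sequences -/


/-- For `x` regular on `M` and `y z = x w`, the elements that multiply `z` into `x M` multiply `w`
into `y M`. -/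
lemma IsSMulRegular.smul_mem_of_smul_eq_smul {R M : Type*} [CommRing R]
    [AddCommGroup M] [Module R M] {x y : R} (hx : IsSMulRegular M x)
    {z w : M} (hzw : y • z = x • w) {a : R} (ha : a • z ∈ x • (⊤ : Submodule R M)) :
    a • w ∈ y • (⊤ : Submodule R M) := by
  obtain ⟨v, -, hv⟩ := (mem_smul_pointwise_iff_exists _ _ _).mp ha
  refine (mem_smul_pointwise_iff_exists _ _ _).mpr ⟨v, mem_top, hx ?_⟩
  change x • y • v = x • a • w
  rw [smul_comm x y, hv, smul_comm x a, ← hzw, smul_comm]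

section Socle

variable {R : Type*} [CommRing R] [IsLocalRing R]

/-- The socle of a module over a local ring: the elements killed by the maximal ideal. -/
abbrev IsLocalRing.socle (R M : Type*) [CommRing R] [IsLocalRing R] [AddCommGroup M] [Module R M] :
    Submodule R M :=
  torsionBySet R M (maximalIdeal R : Set R)

variable {M N : Type*} [AddCommGroup M] [Module R M] [AddCommGroup N] [Module R N]

lemma IsLocalRing.mem_socle {x : M} : x ∈ socle R M ↔ ∀ a ∈ maximalIdeal R, a • x = 0 := by
  simp [mem_torsionBySet_iff]

lemma LinearEquiv.map_socle (e : M ≃ₗ[R] N) : (socle R M).map e.toLinearMap = socle R N := by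
  ext y
  simp only [Submodule.mem_map, mem_socle, LinearEquiv.coe_coe]
  constructor
  · rintro ⟨x, hx, rfl⟩ a ha
    rw [← map_smul, hx a ha, map_zero]
  · intro hy
    refine ⟨e.symm y, fun a ha ↦ ?_, by simp⟩
    rw [← map_smul, hy a ha, map_zero]

/-- Isomorphic modules have isomorphic socles. -/
def LinearEquiv.socleCongr (e : M ≃ₗ[R] N) : socle R M ≃ₗ[R] socle R N :=
  e.ofSubmodules _ _ e.map_socle

lemma IsSMulRegular.socle_eq_bot {x : R} (hx : IsSMulRegular M x) (hxm : x ∈ maximalIdeal R) :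
    socle R M = ⊥ := by
  refine (Submodule.eq_bot_iff _).mpr fun y hy ↦ ?_
  exact hx.right_eq_zero_of_smul (mem_socle.mp hy x hxm)

/-- The pairs `(z, w)` with `y z = x w` and `𝔪 z ⊆ x M`. For `x` and `y` in `𝔪` and regular on `M`
the two projections map it onto the socles of `M / x M` and of `M / y M`, with the same kernel. -/
def socleCorrespondence (M : Type*) [AddCommGroup M] [Module R M] (x y : R) :
    Submodule R (M × M) where
  carrier := {p | y • p.1 = x • p.2 ∧ ∀ a ∈ maximalIdeal R, a • p.1 ∈ x • (⊤ : Submodule R M)}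
  add_mem' := by
    rintro p q ⟨hp, hp'⟩ ⟨hq, hq'⟩
    refine ⟨by simp [smul_add, hp, hq], fun a ha ↦ ?_⟩
    rw [Prod.fst_add, smul_add]
    exact add_mem (hp' a ha) (hq' a ha)
  zero_mem' := by simp
  smul_mem' := by
    rintro c p ⟨hp, hp'⟩
    refine ⟨by simp [smul_comm _ c, hp], fun a ha ↦ ?_⟩
    rw [Prod.smul_fst, smul_comm]
    exact Submodule.smul_mem _ _ (hp' a ha)

lemma IsSMulRegular.mem_socleCorrespondence_swap {x y : R} (hx : IsSMulRegular M x)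
    {p : M × M} (hp : p ∈ socleCorrespondence M x y) : p.swap ∈ socleCorrespondence M y x :=
  ⟨hp.1.symm, fun a ha ↦ hx.smul_mem_of_smul_eq_smul hp.1 (hp.2 a ha)⟩

/-- The first projection of `socleCorrespondence M x y` to the socle of `M / x M`. -/
def socleCorrespondenceFst (M : Type*) [AddCommGroup M] [Module R M] (x y : R) :
    socleCorrespondence M x y →ₗ[R] socle R (QuotSMulTop x M) :=
  LinearMap.codRestrict _
    (((x • (⊤ : Submodule R M)).mkQ ∘ₗ LinearMap.fst R M M) ∘ₗ (socleCorrespondence M x y).subtype)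
    (fun p ↦ mem_socle.mpr fun a ha ↦ by
      simpa [← Submodule.Quotient.mk_smul, Submodule.Quotient.mk_eq_zero] using p.2.2 a ha)

lemma socleCorrespondenceFst_surjective {x y : R} (hy : y ∈ maximalIdeal R) :
    Function.Surjective (socleCorrespondenceFst M x y) := by
  rintro ⟨q, hq⟩
  obtain ⟨z, rfl⟩ := Submodule.mkQ_surjective _ q
  have hz : ∀ a ∈ maximalIdeal R, a • z ∈ x • (⊤ : Submodule R M) := fun a ha ↦ by
    simpa [← Submodule.Quotient.mk_smul, Submodule.Quotient.mk_eq_zero] using mem_socle.mp hq a ha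
  obtain ⟨w, -, hw⟩ := (mem_smul_pointwise_iff_exists _ _ _).mp (hz y hy)
  exact ⟨⟨(z, w), hw.symm, hz⟩, rfl⟩

lemma mem_ker_socleCorrespondenceFst {x y : R} {p : socleCorrespondence M x y} :
    p ∈ (socleCorrespondenceFst M x y).ker ↔ p.1.1 ∈ x • (⊤ : Submodule R M) := by
  rw [LinearMap.mem_ker, ← Submodule.Quotient.mk_eq_zero, ← Subtype.val_inj]
  rfl

/-- If `x` and `y` are both regular on `M`, the socles of `M / x M` and `M / y M` are
isomorphic. -/
lemma IsSMulRegular.nonempty_socle_quotSMulTop_equiv {x y : R} (hx : IsSMulRegular M x)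
    (hy : IsSMulRegular M y) (hxm : x ∈ maximalIdeal R) (hym : y ∈ maximalIdeal R) :
    Nonempty (socle R (QuotSMulTop x M) ≃ₗ[R] socle R (QuotSMulTop y M)) := by
  let e : socleCorrespondence M x y ≃ₗ[R] socleCorrespondence M y x :=
    (LinearEquiv.prodComm R M M).ofSubmodules _ _ (by
      ext p
      constructor
      · rintro ⟨q, hq, rfl⟩
        exact hx.mem_socleCorrespondence_swap hq
      · intro hp
        exact ⟨p.swap, hy.mem_socleCorrespondence_swap hp, by simp⟩)
  let f := socleCorrespondenceFst M x y
  let f' := socleCorrespondenceFst M y x ∘ₗ e.toLinearMap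
  have hf' : Function.Surjective f' := (socleCorrespondenceFst_surjective hxm).comp e.surjective
  have hker : f.ker = f'.ker := by
    ext p
    rw [mem_ker_socleCorrespondenceFst, LinearMap.mem_ker, LinearMap.comp_apply,
      ← LinearMap.mem_ker, mem_ker_socleCorrespondenceFst]
    have h1 : y • p.1.1 = x • p.1.2 := p.2.1
    change p.1.1 ∈ _ ↔ p.1.2 ∈ y • (⊤ : Submodule R M)
    refine ⟨fun h ↦ ?_, fun h ↦ ?_⟩
    · simpa using hx.smul_mem_of_smul_eq_smul (a := 1) h1 (by simpa using h)
    · simpa using hy.smul_mem_of_smul_eq_smul (a := 1) h1.symm (by simpa using h)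
  exact ⟨(f.quotKerEquivOfSurjective (socleCorrespondenceFst_surjective hym)).symm ≪≫ₗ
    Submodule.quotEquivOfEq _ _ hker ≪≫ₗ f'.quotKerEquivOfSurjective hf'⟩

end Socle

section Exchange

variable {R : Type*} [CommRing R] [IsLocalRing R]

/-- Two modules of positive depth have a common regular element in the maximal ideal. -/
lemma IsSMulRegular.exists_common [IsNoetherianRing R] {M N : Type*} [AddCommGroup M] [Module R M]
    [AddCommGroup N] [Module R N] [Module.Finite R M] [Module.Finite R N] {x y : R}
    (hx : IsSMulRegular M x) (hy : IsSMulRegular N y) (hxm : x ∈ maximalIdeal R)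
    (hym : y ∈ maximalIdeal R) :
    ∃ z ∈ maximalIdeal R, IsSMulRegular M z ∧ IsSMulRegular N z := by
  have hann : ∀ a ∈ maximalIdeal R, a ∈ Module.annihilator R (R ⧸ maximalIdeal R) := fun a ha ↦ by
    rwa [Ideal.annihilator_quotient]
  have : Subsingleton ((R ⧸ maximalIdeal R) →ₗ[R] M) :=
    hx.linearMap_subsingleton_of_mem_annihilator (hann x hxm)
  have : Subsingleton ((R ⧸ maximalIdeal R) →ₗ[R] N) :=
    hy.linearMap_subsingleton_of_mem_annihilator (hann y hym)
  have : Subsingleton ((R ⧸ maximalIdeal R) →ₗ[R] M × N) :=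
    (LinearMap.prodEquiv R (M := R ⧸ maximalIdeal R) (M₂ := M) (M₃ := N)).symm.toEquiv.subsingleton
  obtain ⟨z, hz, hreg⟩ := IsSMulRegular.subsingleton_linearMap_iff.mp this
  rw [Ideal.annihilator_quotient] at hz
  exact ⟨z, hz, hreg.of_injective (LinearMap.inl R M N) LinearMap.inl_injective,
    hreg.of_injective (LinearMap.inr R M N) LinearMap.inr_injective⟩

/-- **Exchange of regular sequences.** Two regular sequences of the same length on a finitely
generated module have quotients with isomorphic socles. (Both socles compute
`Ext` of the residue field in the degree given by the length.) -/
theorem RingTheory.Sequence.IsWeaklyRegular.nonempty_socle_equiv [IsNoetherianRing R]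
    {M : Type*} [AddCommGroup M] [Module R M] [Module.Finite R M] {rs rs' : List R}
    (h : IsWeaklyRegular M rs) (h' : IsWeaklyRegular M rs') (hlen : rs.length = rs'.length)
    (hm : ∀ r ∈ rs, r ∈ maximalIdeal R) (hm' : ∀ r ∈ rs', r ∈ maximalIdeal R) :
    Nonempty (socle R (M ⧸ (Ideal.ofList rs • ⊤ : Submodule R M)) ≃ₗ[R]
      socle R (M ⧸ (Ideal.ofList rs' • ⊤ : Submodule R M))) := by
  induction rs generalizing M rs' with
  | nil =>
    obtain rfl : rs' = [] := List.length_eq_zero_iff.mp (by simpa using hlen.symm)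
    exact ⟨LinearEquiv.refl _ _⟩
  | cons a as ih =>
    obtain _ | ⟨b, bs⟩ := rs'
    · simp at hlen
    have last {c : R} {cs : List R} (hc : IsWeaklyRegular M (c :: cs))
        (hcm : ∀ r ∈ c :: cs, r ∈ maximalIdeal R) :
        IsWeaklyRegular M cs ∧ IsSMulRegular (M ⧸ (Ideal.ofList cs • ⊤ : Submodule R M)) c := by
      have := isWeaklyRegular_of_perm_of_subset_maximalIdeal hc
        (List.perm_append_singleton c cs).symm hcm
      rwa [isWeaklyRegular_append_iff, isWeaklyRegular_singleton_iff] at this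
    obtain ⟨has, ha⟩ := last h hm
    obtain ⟨hbs, hb⟩ := last h' hm'
    obtain ⟨z, hzm, hza, hzb⟩ := ha.exists_common hb (hm a (by simp)) (hm' b (by simp))
    have hm₁ : ∀ r ∈ as, r ∈ maximalIdeal R := fun r hr ↦ hm r (by simp [hr])
    have hm₁' : ∀ r ∈ bs, r ∈ maximalIdeal R := fun r hr ↦ hm' r (by simp [hr])
    have first {cs : List R} (hcs : IsWeaklyRegular M cs)
        (hz : IsSMulRegular (M ⧸ (Ideal.ofList cs • ⊤ : Submodule R M)) z)
        (hcm : ∀ r ∈ cs, r ∈ maximalIdeal R) : IsWeaklyRegular (QuotSMulTop z M) cs := by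
      have : IsWeaklyRegular M (cs ++ [z]) := by
        rw [isWeaklyRegular_append_iff, isWeaklyRegular_singleton_iff]
        exact ⟨hcs, hz⟩
      have := isWeaklyRegular_of_perm_of_subset_maximalIdeal this
        (List.perm_append_singleton z cs) (by simpa [or_imp, forall_and] using ⟨hcm, hzm⟩)
      exact ((isWeaklyRegular_cons_iff _ _ _).mp this).2
    -- Exchange one member for `z` on both sides and apply the induction hypothesis to `M / z M`.
    obtain ⟨e⟩ := ih (first has hza hm₁) (first hbs hzb hm₁') (by simpa using hlen) hm₁ hm₁'
    obtain ⟨ea⟩ := ha.nonempty_socle_quotSMulTop_equiv hza (hm a (by simp)) hzm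
    obtain ⟨eb⟩ := hb.nonempty_socle_quotSMulTop_equiv hzb (hm' b (by simp)) hzm
    have tr (cs : List R) : Nonempty
        (socle R (QuotSMulTop z (M ⧸ (Ideal.ofList cs • ⊤ : Submodule R M))) ≃ₗ[R]
          socle R (QuotSMulTop z M ⧸ (Ideal.ofList cs • ⊤ : Submodule R (QuotSMulTop z M)))) :=
      ⟨((quotOfListConsSMulTopEquivQuotSMulTopOuter M z cs).symm ≪≫ₗ
        quotOfListConsSMulTopEquivQuotSMulTopInner M z cs).socleCongr⟩
    obtain ⟨ta⟩ := tr as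
    obtain ⟨tb⟩ := tr bs
    exact ⟨(quotOfListConsSMulTopEquivQuotSMulTopOuter M a as).socleCongr ≪≫ₗ ea ≪≫ₗ ta ≪≫ₗ e ≪≫ₗ
      tb.symm ≪≫ₗ eb.symm ≪≫ₗ (quotOfListConsSMulTopEquivQuotSMulTopOuter M b bs).symm.socleCongr⟩

/-- The quotient by a regular sequence that is shorter than another one has depth at least one. -/
lemma RingTheory.Sequence.IsWeaklyRegular.socle_eq_bot_of_length_lt [IsNoetherianRing R]
    {M : Type*} [AddCommGroup M] [Module R M] [Module.Finite R M] {rs rs' : List R}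
    (h : IsWeaklyRegular M rs) (h' : IsWeaklyRegular M rs') (hlen : rs.length < rs'.length)
    (hm : ∀ r ∈ rs, r ∈ maximalIdeal R) (hm' : ∀ r ∈ rs', r ∈ maximalIdeal R) :
    socle R (M ⧸ (Ideal.ofList rs • ⊤ : Submodule R M)) = ⊥ := by
  have htake : IsWeaklyRegular M (rs'.take rs.length) := by
    rw [← List.take_append_drop rs.length rs', isWeaklyRegular_append_iff] at h'
    exact h'.1
  obtain ⟨e⟩ := h.nonempty_socle_equiv htake (by simp [hlen.le]) hm
    fun r hr ↦ hm' r (List.mem_of_mem_take hr)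
  have hbot := (h'.regular_mod_prev _ hlen).socle_eq_bot (hm' _ (List.getElem_mem hlen))
  have : Subsingleton (socle R (M ⧸ (Ideal.ofList (rs'.take rs.length) • ⊤ : Submodule R M))) := by
    rw [hbot]; infer_instance
  exact (Submodule.subsingleton_iff_eq_bot).mp e.toEquiv.subsingleton

end Exchange

/-! ### Powers of regular sequences -/

section Powers

variable {R : Type*} [CommRing R]

/-- Weak regularity passes to the middle term of a short exact sequence. -/
lemma RingTheory.Sequence.IsWeaklyRegular.of_exact {M₁ M₂ M₃ : Type*} [AddCommGroup M₁]
    [Module R M₁] [AddCommGroup M₂] [Module R M₂] [AddCommGroup M₃] [Module R M₃]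
    {f : M₁ →ₗ[R] M₂} {g : M₂ →ₗ[R] M₃} (hf : Function.Injective f) (hfg : Function.Exact f g)
    (hg : Function.Surjective g) {rs : List R} (h₁ : IsWeaklyRegular M₁ rs)
    (h₃ : IsWeaklyRegular M₃ rs) : IsWeaklyRegular M₂ rs := by
  induction rs generalizing M₁ M₂ M₃ with
  | nil => exact .nil R M₂
  | cons r rs ih =>
    rw [isWeaklyRegular_cons_iff] at h₁ h₃ ⊢
    refine ⟨isSMulRegular_of_range_eq_ker hf hfg.linearMap_ker_eq.symm h₁.1 h₃.1, ?_⟩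
    refine ih ?_ (QuotSMulTop.map_exact r hfg hg) (QuotSMulTop.map_surjective r hg) h₁.2 h₃.2
    have h0 : Function.Exact (0 : M₁ →ₗ[R] M₁) f := by
      rw [LinearMap.exact_zero_iff_injective]; exact hf
    have := QuotSMulTop.map_first_exact_on_four_term_exact_of_isSMulRegular_last h0 hfg h₃.1
    rw [map_zero] at this
    rwa [LinearMap.exact_zero_iff_injective] at this

lemma RingTheory.Sequence.IsWeaklyRegular.cons_pow {M : Type*} [AddCommGroup M] [Module R M]
    {r : R} {rs : List R} (h : IsWeaklyRegular M (r :: rs)) (k : ℕ) :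
    IsWeaklyRegular M (r ^ k :: rs) := by
  rw [isWeaklyRegular_cons_iff] at h ⊢
  refine ⟨h.1.pow k, ?_⟩
  induction k with
  | zero =>
    have : Subsingleton (QuotSMulTop (r ^ 0) M) := by
      rw [pow_zero, Submodule.Quotient.subsingleton_iff, one_smul]
    exact ⟨fun i hi ↦ Function.injective_of_subsingleton _⟩
  | succ k ih =>
    -- The exact sequence `0 → M / r ^ k M → M / r ^ (k + 1) M → M / r M → 0`, whose first map is
    -- multiplication by `r`.
    let f : QuotSMulTop (r ^ k) M →ₗ[R] QuotSMulTop (r ^ (k + 1)) M :=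
      mapQ _ _ (LinearMap.lsmul R M r) (by
        rintro _ ⟨x, -, rfl⟩
        exact ⟨x, mem_top, by simp [pow_succ, mul_smul]⟩)
    let g : QuotSMulTop (r ^ (k + 1)) M →ₗ[R] QuotSMulTop r M :=
      factor (by
        rintro _ ⟨x, -, rfl⟩
        exact ⟨r ^ k • x, mem_top, by simp [smul_smul, pow_succ]⟩)
    refine IsWeaklyRegular.of_exact (f := f) (g := g) ?_ ?_ (factor_surjective _) ih h.2
    · rw [injective_iff_map_eq_zero]
      intro x hx
      obtain ⟨x, rfl⟩ := mkQ_surjective _ x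
      have hx : r • x ∈ r ^ (k + 1) • (⊤ : Submodule R M) := by
        rw [← Submodule.Quotient.mk_eq_zero]; exact hx
      obtain ⟨y, -, hy⟩ := (mem_smul_pointwise_iff_exists _ _ _).mp hx
      refine (Submodule.Quotient.mk_eq_zero _).mpr ⟨y, mem_top, h.1 ?_⟩
      rw [pow_succ', mul_smul] at hy
      exact hy
    · intro x
      obtain ⟨x, rfl⟩ := mkQ_surjective _ x
      constructor
      · intro hx
        have hx : x ∈ r • (⊤ : Submodule R M) := by
          rw [← Submodule.Quotient.mk_eq_zero]; exact hx
        obtain ⟨y, -, rfl⟩ := (mem_smul_pointwise_iff_exists _ _ _).mp hx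
        exact ⟨mkQ _ y, rfl⟩
      · rintro ⟨y, hy⟩
        obtain ⟨y, rfl⟩ := mkQ_surjective _ y
        rw [← hy]
        exact (Submodule.Quotient.mk_eq_zero _).mpr ⟨y, mem_top, rfl⟩

lemma RingTheory.Sequence.IsWeaklyRegular.map_pow {M ι : Type*} [AddCommGroup M] [Module R M]
    {l : List ι} {g : ι → R} (h : IsWeaklyRegular M (l.map g)) (e : ι → ℕ) :
    IsWeaklyRegular M (l.map fun i ↦ g i ^ e i) := by
  induction l generalizing M with
  | nil => exact .nil R M
  | cons i l ih =>
    rw [List.map_cons, isWeaklyRegular_cons_iff] at h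
    exact (IsWeaklyRegular.cons h.1 (ih h.2)).cons_pow (e i)

/-- In a regular sequence `g` of a noetherian local ring, `g i` remains a nonzerodivisor modulo any
powers of the other members. -/
lemma RingTheory.Sequence.IsWeaklyRegular.mem_span_pow_of_mul_mem [IsLocalRing R]
    [IsNoetherianRing R] {n : ℕ} {g : Fin n → R} (h : IsWeaklyRegular R (List.ofFn g))
    (hm : ∀ i, g i ∈ maximalIdeal R) (e : Fin n → ℕ) (he : ∀ i, e i ≠ 0) (i : Fin n) {x : R}
    (hx : g i * x ∈ Ideal.span ((fun j ↦ g j ^ e j) '' {i}ᶜ)) :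
    x ∈ Ideal.span ((fun j ↦ g j ^ e j) '' {i}ᶜ) := by
  set l := (List.finRange n).erase i with hl
  have hperm : (List.finRange n).Perm (i :: l) := List.perm_cons_erase (List.mem_finRange i)
  have hlm : ∀ j, j ∈ l ↔ j ≠ i := fun j ↦ by
    simp [hl, (List.nodup_finRange n).mem_erase_iff]
  rw [List.ofFn_eq_map] at h
  have h1 := isWeaklyRegular_of_perm_of_subset_maximalIdeal h (hperm.map g) (by simpa using hm)
  rw [List.map_cons, isWeaklyRegular_cons_iff] at h1
  have h2 := IsWeaklyRegular.cons h1.1 (h1.2.map_pow e)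
  have h3 := isWeaklyRegular_of_perm_of_subset_maximalIdeal h2 (List.perm_append_singleton _ _).symm
    (by
      simp only [List.mem_cons, List.mem_map]
      rintro r (rfl | ⟨j, -, rfl⟩)
      · exact hm i
      · exact Ideal.pow_mem_of_mem _ (hm j) _ (Nat.pos_of_ne_zero (he j)))
  rw [isWeaklyRegular_append_iff, isWeaklyRegular_singleton_iff,
    isSMulRegular_quotient_iff_mem_of_smul_mem] at h3
  have hset : Ideal.ofList (l.map fun j ↦ g j ^ e j) =
      Ideal.span ((fun j ↦ g j ^ e j) '' {i}ᶜ) := by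
    refine congrArg Ideal.span (Set.ext fun r ↦ ?_)
    simp [hlm]
  have := h3.2 x
  rw [hset, smul_eq_mul, Ideal.mul_top] at this
  exact this hx

end Powers

/-! ### Determinants of transition matrices -/

section Determinant

open Matrix

variable {R : Type*} [CommRing R] {n : ℕ}

lemma Matrix.mulVec_apply_mem {m : ℕ} {I : Ideal R} (B : Matrix (Fin m) (Fin n) R) {v : Fin n → R}
    (hv : ∀ k, v k ∈ I) (i : Fin m) : (B *ᵥ v) i ∈ I := by
  rw [mulVec, dotProduct]
  exact Ideal.sum_mem _ fun k _ ↦ Ideal.mul_mem_left _ _ (hv k)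

/-- Two matrices that express `g ^ e` through `g` have the same determinant modulo `g ^ e`, if each
`g i` is a nonzerodivisor modulo the powers of the other members. -/
lemma Matrix.det_sub_det_mem_span_of_mulVec_eq {g : Fin n → R} {e : Fin n → ℕ}
    (hg : ∀ i x, g i * x ∈ Ideal.span ((fun j ↦ g j ^ e j) '' {i}ᶜ) →
      x ∈ Ideal.span ((fun j ↦ g j ^ e j) '' {i}ᶜ))
    {C D : Matrix (Fin n) (Fin n) R} (hC : C *ᵥ g = fun i ↦ g i ^ e i)
    (hD : D *ᵥ g = fun i ↦ g i ^ e i) :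
    C.det - D.det ∈ Ideal.span (Set.range fun i ↦ g i ^ e i) := by
  set U := Ideal.span (Set.range fun i ↦ g i ^ e i)
  -- The rows of `D` are replaced by those of `C` one at a time.
  suffices H : ∀ s : Finset (Fin n),
      (Matrix.of fun i ↦ if i ∈ s then C i else D i).det - D.det ∈ U by
    have := H Finset.univ
    simp only [Finset.mem_univ, if_true] at this
    exact this
  intro s
  induction s using Finset.induction_on with
  | empty => simp only [Finset.notMem_empty, if_false]; convert U.zero_mem; exact sub_self _
  | insert i s his ih =>
    set E : Matrix (Fin n) (Fin n) R := Matrix.of fun k ↦ if k ∈ s then C k else D k with hE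
    have hins : (Matrix.of fun k ↦ if k ∈ insert i s then C k else D k) = E.updateRow i (C i) := by
      ext k l
      by_cases hk : k = i
      · subst hk; simp
      · simp [hE, hk]
    have hEi : E = E.updateRow i (D i) := by
      ext k l
      by_cases hk : k = i
      · subst hk; simp [hE, his]
      · simp [hk]
    set F := E.updateRow i (C i - D i) with hF
    have hdet : (E.updateRow i (C i)).det = F.det + E.det := by
      have := det_updateRow_add E i (C i - D i) (D i)
      rwa [sub_add_cancel, ← hEi] at this
    have hrow : ∀ k, k ≠ i → (F *ᵥ g) k = g k ^ e k := fun k hk ↦ by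
      have : (F *ᵥ g) k = if k ∈ s then (C *ᵥ g) k else (D *ᵥ g) k := by
        simp only [mulVec, hF, updateRow_ne hk, hE]
        split_ifs <;> simp [*]
      rw [this, hC, hD, ite_self]
    have hrow' : (F *ᵥ g) i = 0 := by
      have : (F *ᵥ g) i = (C *ᵥ g) i - (D *ᵥ g) i := by
        simp only [mulVec, hF, updateRow_self]
        exact sub_dotProduct _ _ _
      rw [this, hC, hD, sub_self]
    have hmul : g i * F.det ∈ Ideal.span ((fun j ↦ g j ^ e j) '' {i}ᶜ) := by
      have : g i * F.det = (F.adjugate *ᵥ (F *ᵥ g)) i := by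
        rw [mulVec_mulVec, adjugate_mul, smul_mulVec, one_mulVec, Pi.smul_apply, smul_eq_mul,
          mul_comm]
      rw [this]
      refine mulVec_apply_mem _ (fun k ↦ ?_) i
      by_cases hk : k = i
      · rw [hk, hrow']; exact zero_mem _
      · rw [hrow k hk]
        exact Ideal.subset_span ⟨k, hk, rfl⟩
    have hFU : F.det ∈ U := Ideal.span_mono (Set.image_subset_range _ _) (hg i _ hmul)
    rw [hins, hdet, add_sub_assoc]
    exact add_mem hFU ih

/-- The monomial property of regular sequences, for `g` such that each `g i` is a nonzerodivisor
modulo any powers of the other members. -/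
lemma prod_pow_notMem_span_pow_succ {g : Fin n → R} (hne : Ideal.span (Set.range g) ≠ ⊤)
    (hg : ∀ (e : Fin n → ℕ), (∀ i, e i ≠ 0) → ∀ i x,
      g i * x ∈ Ideal.span ((fun j ↦ g j ^ e j) '' {i}ᶜ) →
      x ∈ Ideal.span ((fun j ↦ g j ^ e j) '' {i}ᶜ)) (e : Fin n → ℕ) :
    ∏ i, g i ^ e i ∉ Ideal.span (Set.range fun i ↦ g i ^ (e i + 1)) := by
  induction h : ∑ i, e i generalizing e with
  | zero =>
    have he : ∀ i, e i = 0 := by simpa using h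
    simpa [he, ← Ideal.eq_top_iff_one] using hne
  | succ k ih =>
    obtain ⟨i, hi⟩ : ∃ i, e i ≠ 0 := by
      by_contra! H
      simp [H] at h
    obtain ⟨p, hp⟩ := Nat.exists_eq_succ_of_ne_zero hi
    -- Cancel one factor `g i` and lower the exponent of `g i` by one.
    set e' := Function.update e i p with he'
    have hprod : ∏ j, g j ^ e j = g i * ∏ j, g j ^ e' j := by
      rw [← Finset.mul_prod_erase _ _ (Finset.mem_univ i),
        ← Finset.mul_prod_erase _ (fun j ↦ g j ^ e' j) (Finset.mem_univ i), ← mul_assoc,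
        hp, he', Function.update_self, pow_succ']
      congr 1
      exact Finset.prod_congr rfl fun j hj ↦ by
        rw [Function.update_of_ne (Finset.ne_of_mem_erase hj)]
    have hsum : ∑ j, e' j = k := by
      rw [← Finset.add_sum_erase _ _ (Finset.mem_univ i)] at h ⊢
      have : ∑ j ∈ Finset.univ.erase i, e' j = ∑ j ∈ Finset.univ.erase i, e j :=
        Finset.sum_congr rfl fun j hj ↦ by
          rw [he', Function.update_of_ne (Finset.ne_of_mem_erase hj)]
      rw [this, he', Function.update_self]
      omega
    have hsplit (d : Fin n → ℕ) : Ideal.span (Set.range fun j ↦ g j ^ d j) =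
        Ideal.span {g i ^ d i} ⊔ Ideal.span ((fun j ↦ g j ^ d j) '' {i}ᶜ) := by
      rw [← Ideal.span_union, ← Set.image_singleton (f := fun j ↦ g j ^ d j), ← Set.image_union,
        Set.union_compl_self, Set.image_univ]
    have himg : (fun j ↦ g j ^ (e' j + 1)) '' {i}ᶜ = (fun j ↦ g j ^ (e j + 1)) '' {i}ᶜ :=
      Set.image_congr fun j hj ↦ by rw [he', Function.update_of_ne hj]
    intro hmem
    refine ih e' hsum ?_
    rw [hsplit fun j ↦ e j + 1, Ideal.mem_span_singleton_sup] at hmem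
    obtain ⟨a, b, hb, hab⟩ := hmem
    have key : ∏ j, g j ^ e' j - a * g i ^ e i ∈
        Ideal.span ((fun j ↦ g j ^ (e j + 1)) '' {i}ᶜ) := by
      refine hg (fun j ↦ e j + 1) (fun _ ↦ Nat.succ_ne_zero _) i _ ?_
      have : g i * (∏ j, g j ^ e' j - a * g i ^ e i) = b := by
        rw [mul_sub, ← hprod, ← hab]; ring
      rwa [this]
    rw [hsplit fun j ↦ e' j + 1, himg, Ideal.mem_span_singleton_sup]
    refine ⟨a, _, key, ?_⟩
    have : e' i = p := Function.update_self ..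
    rw [this, hp, Nat.succ_eq_add_one, pow_succ]
    ring

/-- If `h = A g` for a regular sequence `g` and the ideal `(h)` contains a power of each `g i`, then
`det A` does not lie in `(h)`. -/
lemma Matrix.det_notMem_span_range_mulVec {g : Fin n → R} (hne : Ideal.span (Set.range g) ≠ ⊤)
    (hg : ∀ (e : Fin n → ℕ), (∀ i, e i ≠ 0) → ∀ i x,
      g i * x ∈ Ideal.span ((fun j ↦ g j ^ e j) '' {i}ᶜ) →
      x ∈ Ideal.span ((fun j ↦ g j ^ e j) '' {i}ᶜ))
    (A : Matrix (Fin n) (Fin n) R) {N : ℕ}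
    (hN : ∀ i, g i ^ (N + 1) ∈ Ideal.span (Set.range (A *ᵥ g))) :
    A.det ∉ Ideal.span (Set.range (A *ᵥ g)) := by
  intro hA
  have : ∀ i, ∃ b : Fin n → R, ∑ j, b j * (A *ᵥ g) j = g i ^ (N + 1) := fun i ↦
    Ideal.mem_span_range_iff_exists_fun.mp (hN i)
  choose B hB using this
  have hBg : (Matrix.of B) *ᵥ (A *ᵥ g) = fun i ↦ g i ^ (N + 1) := funext hB
  set U := Ideal.span (Set.range fun i ↦ g i ^ (N + 1)) with hU
  have h1 : ((Matrix.of B) * A).det - (diagonal fun i ↦ g i ^ N).det ∈ U :=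
    det_sub_det_mem_span_of_mulVec_eq (hg _ fun _ ↦ Nat.succ_ne_zero _)
      (by rw [← mulVec_mulVec, hBg])
      (by ext i; rw [mulVec_diagonal, pow_succ])
  -- By Cramer's rule `det B` multiplies `(h)` into `(g ^ (N + 1))`.
  have h2 : ∀ x ∈ Ideal.span (Set.range (A *ᵥ g)), (Matrix.of B).det * x ∈ U := by
    intro x hx
    induction hx using Submodule.span_induction with
    | mem x hx =>
      obtain ⟨j, rfl⟩ := hx
      have : (Matrix.of B).det * (A *ᵥ g) j =
          ((Matrix.of B).adjugate *ᵥ ((Matrix.of B) *ᵥ (A *ᵥ g))) j := by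
        rw [mulVec_mulVec, adjugate_mul, smul_mulVec, one_mulVec,
          Pi.smul_apply, smul_eq_mul]
      rw [this, hBg]
      exact mulVec_apply_mem _ (fun k ↦ Ideal.subset_span (Set.mem_range_self k)) j
    | zero => simp
    | add x y _ _ hx hy => rw [mul_add]; exact add_mem hx hy
    | smul a x _ hx => rw [smul_eq_mul, mul_left_comm]; exact Ideal.mul_mem_left _ _ hx
  have h3 : ∏ i, g i ^ N ∈ U := by
    rw [det_diagonal, det_mul] at h1
    exact (Submodule.sub_mem_iff_right _ (h2 _ hA)).mp h1
  exact prod_pow_notMem_span_pow_succ hne hg (fun _ ↦ N) h3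

/-- If all maximal minors of `W` lie in an ideal, then so does the determinant of every product
`B * Wᵀ`. -/
lemma Matrix.det_mul_transpose_mem {r : ℕ} {q : Ideal R} {W : Matrix (Fin n) (Fin r) R}
    (hW : ∀ c : Fin n ↪o Fin r, (W.submatrix id c).det ∈ q) (B : Matrix (Fin n) (Fin r) R) :
    (B * Wᵀ).det ∈ q := by
  have hexp : (B * Wᵀ).det =
      ∑ c : Fin n → Fin r, (∏ i, B i (c i)) * (Wᵀ.submatrix c id).det := by
    have : B * Wᵀ = fun i ↦ ∑ j, B i j • Wᵀ j := by
      ext i k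
      simp [mul_apply, Finset.sum_apply]
    have h2 := (detRowAlternating (n := Fin n) (R := R)).toMultilinearMap.map_sum
      (fun i j ↦ B i j • Wᵀ j)
    rw [this]
    refine h2.trans (Finset.sum_congr rfl fun c _ ↦ ?_)
    exact (detRowAlternating (n := Fin n) (R := R)).toMultilinearMap.map_smul_univ
      (fun i ↦ B i (c i)) (fun i ↦ Wᵀ (c i))
  rw [hexp]
  refine Ideal.sum_mem _ fun c _ ↦ Ideal.mul_mem_left _ _ ?_
  by_cases hc : Function.Injective c
  · have hmono : StrictMono (c ∘ Tuple.sort c) :=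
      (Tuple.monotone_sort c).strictMono_of_injective (hc.comp (Tuple.sort c).injective)
    have h1 := det_permute (Tuple.sort c) (Wᵀ.submatrix c id)
    have h2 : (Wᵀ.submatrix c id).submatrix (Tuple.sort c) id =
        (W.submatrix id (OrderEmbedding.ofStrictMono _ hmono))ᵀ := rfl
    rw [h2, det_transpose] at h1
    have h3 := hW (OrderEmbedding.ofStrictMono _ hmono)
    rw [h1] at h3
    have h4 := Ideal.mul_mem_left q ((Equiv.Perm.sign (Tuple.sort c) : ℤ) : R) h3
    rwa [← mul_assoc, ← Int.cast_mul, ← Units.val_mul, Int.units_mul_self, Units.val_one,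
      Int.cast_one, one_mul] at h4
  · obtain ⟨i, j, hij, hne⟩ : ∃ i j, c i = c j ∧ i ≠ j := by
      simpa [Function.Injective] using hc
    rw [det_zero_of_row_eq hne (by ext k; simp [hij])]
    exact zero_mem _

end Determinant

/-! ### Regular sequences in a coset -/

section Coset

variable {R : Type*} [CommRing R]

lemma Ideal.ofList_ofFn {n : ℕ} (h : Fin n → R) :
    Ideal.ofList (List.ofFn h) = Ideal.span (Set.range h) :=
  congrArg Ideal.span (Set.ext fun _ ↦ List.mem_ofFn)

lemma IsLocalRing.mk_mem_socle [IsLocalRing R] {J : Ideal R} {z : R}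
    (hz : ∀ a ∈ maximalIdeal R, a * z ∈ J) :
    (Submodule.Quotient.mk z : R ⧸ J) ∈ socle R (R ⧸ J) :=
  mem_socle.mpr fun a ha ↦ by
    rw [← Submodule.Quotient.mk_smul, Submodule.Quotient.mk_eq_zero]
    exact hz a ha

/-- Prime avoidance in a coset `a + I`. -/
lemma Ideal.exists_add_notMem_of_finset (S : Finset (Ideal R)) (hS : ∀ p ∈ S, p.IsPrime)
    {I : Ideal R} (hI : ∀ p ∈ S, ¬ I ≤ p) (a : R) : ∃ y ∈ I, ∀ p ∈ S, a + y ∉ p := by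
  classical
  induction S using Finset.strongInduction with
  | H S ih =>
    obtain rfl | hne := S.eq_empty_or_nonempty
    · exact ⟨0, I.zero_mem, by simp⟩
    obtain ⟨p, hp⟩ := S.exists_minimal hne
    obtain ⟨y, hyI, hy⟩ := ih (S.erase p) (Finset.erase_ssubset hp.1)
      (fun q hq ↦ hS q (Finset.mem_of_mem_erase hq)) (fun q hq ↦ hI q (Finset.mem_of_mem_erase hq))
    by_cases hyp : a + y ∈ p
    · -- By minimality of `p` there is a correction term in the other primes but not in `p`.
      have hnot : ¬ I ⊓ (S.erase p).inf id ≤ p := by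
        rw [(hS p hp.1).inf_le, (hS p hp.1).inf_le']
        rintro (h | ⟨q, hq, hqp⟩)
        · exact hI p hp.1 h
        · exact (Finset.ne_of_mem_erase hq)
            (le_antisymm hqp (hp.2 (Finset.mem_of_mem_erase hq) hqp))
      obtain ⟨t, ⟨htI, ht⟩, htp⟩ := SetLike.not_le_iff_exists.mp hnot
      refine ⟨y + t, add_mem hyI htI, fun q hq h ↦ ?_⟩
      rw [← add_assoc] at h
      by_cases hqp : q = p
      · subst hqp
        exact htp ((Submodule.add_mem_iff_right _ hyp).mp h)
      · have hq' : q ∈ S.erase p := Finset.mem_erase.mpr ⟨hqp, hq⟩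
        have htq : t ∈ q := (Finset.inf_le hq' : (S.erase p).inf id ≤ id q) ht
        exact hy q hq' ((Submodule.add_mem_iff_left _ htq).mp h)
    · refine ⟨y, hyI, fun q hq ↦ ?_⟩
      by_cases hqp : q = p
      · rwa [hqp]
      · exact hy q (Finset.mem_erase.mpr ⟨hqp, hq⟩)

variable [IsLocalRing R] [IsNoetherianRing R]

/-- On a module of positive depth, every coset of an `𝔪`-primary ideal contains a regular
element. -/
lemma IsLocalRing.exists_add_isSMulRegular {M : Type*} [AddCommGroup M] [Module R M]
    [Module.Finite R M] (hM : socle R M = ⊥) {I : Ideal R} (hI : maximalIdeal R ≤ I.radical)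
    (a : R) : ∃ y ∈ I, IsSMulRegular M (a + y) := by
  obtain ⟨y, hyI, hy⟩ := Ideal.exists_add_notMem_of_finset (associatedPrimes.finite R M).toFinset
    (fun p hp ↦ ((Set.Finite.mem_toFinset _).mp hp).isPrime) (I := I) (by
      intro p hp hle
      have hp : IsAssociatedPrime p M := (Set.Finite.mem_toFinset _).mp hp
      have hpr := hp.isPrime
      have hpm : maximalIdeal R ≤ p := hI.trans (hpr.radical_le_iff.mpr hle)
      obtain ⟨x, hx⟩ := (isAssociatedPrime_iff.mp hp).2
      have hxs : x ∈ socle R M := mem_socle.mpr fun b hb ↦ by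
        have := hpm hb
        rw [hx] at this
        simpa using mem_colon_singleton.mp this
      rw [hM, Submodule.mem_bot] at hxs
      exact hpr.ne_top (by rw [hx, hxs]; ext; simp)) a
  refine ⟨y, hyI, ?_⟩
  by_contra hreg
  have : a + y ∈ ({r : R | IsSMulRegular M r}ᶜ : Set R) := hreg
  rw [← biUnion_associatedPrimes_eq_compl_regular] at this
  obtain ⟨p, hp, hyp⟩ := Set.mem_iUnion₂.mp this
  exact hy p (by simpa using hp) hyp

/-- If `𝔪` contains a regular sequence `gs`, then any `k ≤ gs.length` elements of `𝔪` become a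
regular sequence after adding suitable elements of a given `𝔪`-primary ideal. -/
lemma IsLocalRing.exists_isWeaklyRegular_sub_mem {gs : List R} (hgs : IsWeaklyRegular R gs)
    (hgm : ∀ r ∈ gs, r ∈ maximalIdeal R) {I : Ideal R} (hI : maximalIdeal R ≤ I.radical)
    (hIm : I ≤ maximalIdeal R) {k : ℕ} (hk : k ≤ gs.length) (φ : Fin k → R)
    (hφ : ∀ i, φ i ∈ maximalIdeal R) :
    ∃ h : Fin k → R, IsWeaklyRegular R (List.ofFn h) ∧ ∀ i, h i - φ i ∈ I := by
  induction k with
  | zero => exact ⟨φ, by simp, fun i ↦ i.elim0⟩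
  | succ k ih =>
    obtain ⟨h, hreg, hh⟩ := ih (by omega) (fun i ↦ φ i.castSucc) (fun i ↦ hφ _)
    have hhm : ∀ i, h i ∈ maximalIdeal R := fun i ↦
      (Submodule.sub_mem_iff_left _ (hφ i.castSucc)).mp (hIm (hh i))
    have hsoc := hreg.socle_eq_bot_of_length_lt hgs (by simp; omega)
      (by simpa [List.mem_ofFn] using hhm) hgm
    obtain ⟨y, hyI, hy⟩ := exists_add_isSMulRegular hsoc hI (φ (Fin.last k))
    refine ⟨Fin.snoc h (φ (Fin.last k) + y), ?_, fun i ↦ ?_⟩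
    · rw [List.ofFn_succ', List.concat_eq_append, isWeaklyRegular_append_iff,
        isWeaklyRegular_singleton_iff]
      have hsnoc : (fun i : Fin k ↦
          (Fin.snoc h (φ (Fin.last k) + y) : Fin (k + 1) → R) i.castSucc) = h :=
        funext fun i ↦ Fin.snoc_castSucc (α := fun _ ↦ R) _ _ i
      rw [hsnoc, Fin.snoc_last]
      exact ⟨hreg, hy⟩
    · induction i using Fin.lastCases with
      | last => simpa using hyI
      | cast i => simpa using hh i

end Coset

/-! ### Primary ideals in a local ring with regularly generated maximal ideal -/

section Local

open Matrix

variable {R : Type*} [CommRing R] [IsLocalRing R] [IsNoetherianRing R] {n : ℕ}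

/-- A nonzero submodule `(q + J) / J` of `R / J` meets the socle if `J` is `𝔪`-primary. -/
lemma IsLocalRing.exists_notMem_of_le_radical {J q : Ideal R} (hJ : maximalIdeal R ≤ J.radical)
    (hq : ¬ q ≤ J) : ∃ z ∈ q, z ∉ J ∧ ∀ a ∈ maximalIdeal R, a * z ∈ J := by
  classical
  obtain ⟨N, hN⟩ := Ideal.exists_pow_le_of_le_radical_of_fg hJ
    (maximalIdeal R).fg_of_isNoetherianRing
  have hex : ∃ k, maximalIdeal R ^ k * q ≤ J := ⟨N, Ideal.mul_le_left.trans hN⟩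
  obtain hk | ⟨k, hk⟩ : Nat.find hex = 0 ∨ ∃ k, Nat.find hex = k + 1 := by
    cases Nat.find hex <;> simp
  · have := Nat.find_spec hex
    rw [hk, pow_zero, one_mul] at this
    exact absurd this hq
  · have hlt := Nat.find_min hex (m := k) (by omega)
    have hsp := Nat.find_spec hex
    rw [hk] at hsp
    obtain ⟨z, hz, hzJ⟩ := SetLike.not_le_iff_exists.mp hlt
    refine ⟨z, Ideal.mul_le_right hz, hzJ, fun a ha ↦ hsp ?_⟩
    rw [pow_succ', mul_assoc]
    exact Ideal.mul_mem_mul ha hz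

section

variable {gs hs : List R} (hgs : IsWeaklyRegular R gs) (hgm : Ideal.ofList gs = maximalIdeal R)
  (hhs : IsWeaklyRegular R hs) (hhm : Ideal.ofList hs ≤ maximalIdeal R)

include hgs hgm hhs hhm

lemma IsLocalRing.nonempty_socle_equiv_of_length_eq (hlen : hs.length = gs.length) :
    Nonempty (socle R (R ⧸ Ideal.ofList hs) ≃ₗ[R] socle R (R ⧸ maximalIdeal R)) := by
  have := hhs.nonempty_socle_equiv hgs hlen (fun r hr ↦ hhm (Ideal.subset_span hr))
    (fun r hr ↦ hgm.le (Ideal.subset_span hr))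
  rwa [smul_eq_mul, smul_eq_mul, Ideal.mul_top, Ideal.mul_top, hgm] at this

/-- A regular sequence that generates an `𝔪`-primary ideal is as long as one that generates `𝔪`. -/
lemma IsLocalRing.length_eq_of_le_radical (hrad : maximalIdeal R ≤ (Ideal.ofList hs).radical) :
    hs.length = gs.length := by
  have hhm' : ∀ r ∈ hs, r ∈ maximalIdeal R := fun r hr ↦ hhm (Ideal.subset_span hr)
  have hgm' : ∀ r ∈ gs, r ∈ maximalIdeal R := fun r hr ↦ hgm.le (Ideal.subset_span hr)
  have hne {J : Ideal R} (hJ : J ≤ maximalIdeal R) (hrad : maximalIdeal R ≤ J.radical) :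
      socle R (R ⧸ J) ≠ ⊥ := fun hbot ↦ by
    obtain ⟨z, -, hzJ, hz⟩ := exists_notMem_of_le_radical (q := ⊤) hrad fun h ↦
      (maximalIdeal.isMaximal R).ne_top (top_le_iff.mp (h.trans hJ))
    have := mk_mem_socle hz
    rw [hbot, Submodule.mem_bot, Submodule.Quotient.mk_eq_zero] at this
    exact hzJ this
  refine le_antisymm (not_lt.mp fun hlt ↦ ?_) (not_lt.mp fun hlt ↦ ?_)
  · have := hgs.socle_eq_bot_of_length_lt hhs hlt hgm' hhm'
    rw [smul_eq_mul, Ideal.mul_top, hgm] at this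
    exact hne le_rfl Ideal.le_radical this
  · have := hhs.socle_eq_bot_of_length_lt hgs hlt hhm' hgm'
    rw [smul_eq_mul, Ideal.mul_top] at this
    exact hne hhm hrad this

/-- A regular sequence as long as one that generates `𝔪` generates an `𝔪`-primary ideal, because
both lower the Krull dimension by their length. -/
lemma IsLocalRing.le_radical_of_length_eq (hlen : hs.length = gs.length) :
    maximalIdeal R ≤ (Ideal.ofList hs).radical := by
  have h1 := ringKrullDim_add_length_eq_ringKrullDim_of_isRegular hs
    (.of_isWeaklyRegular_of_mem_maximalIdeal R (fun r hr ↦ hhm (Ideal.subset_span hr)) hhs)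
  have h2 := ringKrullDim_add_length_eq_ringKrullDim_of_isRegular gs
    (.of_isWeaklyRegular_of_mem_maximalIdeal R (fun r hr ↦ hgm.le (Ideal.subset_span hr)) hgs)
  have h3 : ringKrullDim (R ⧸ Ideal.ofList gs) = 0 := by
    rw [hgm]
    exact ringKrullDim_eq_zero_of_isField
      ((Ideal.Quotient.maximal_ideal_iff_isField_quotient _).mp inferInstance)
  rw [← h2, hlen, ENat.WithBot.add_natCast_cancel, h3] at h1
  have h5 : Ring.KrullDimLE 0 (R ⧸ Ideal.ofList hs) := Ring.krullDimLE_iff.mpr h1.le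
  rw [Ideal.krullDimLE_zero_quotient_iff_forall_minimalPrimes_isMaximal] at h5
  rw [← Ideal.sInf_minimalPrimes]
  exact le_sInf fun p hp ↦ (eq_maximalIdeal (h5 p hp)).ge

/-- The quotient by a maximal regular sequence has a simple socle: any two elements of it are
proportional. -/
lemma IsLocalRing.exists_sub_mul_mem (hlen : hs.length = gs.length) {z w : R}
    (hz : ∀ a ∈ maximalIdeal R, a * z ∈ Ideal.ofList hs) (hzJ : z ∉ Ideal.ofList hs)
    (hw : ∀ a ∈ maximalIdeal R, a * w ∈ Ideal.ofList hs) :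
    ∃ a, w - a * z ∈ Ideal.ofList hs := by
  obtain ⟨e⟩ := nonempty_socle_equiv_of_length_eq hgs hgm hhs hhm hlen
  set z' : socle R (R ⧸ Ideal.ofList hs) := ⟨_, mk_mem_socle hz⟩ with hz'
  set w' : socle R (R ⧸ Ideal.ofList hs) := ⟨_, mk_mem_socle hw⟩ with hw'
  obtain ⟨u, hu⟩ := Submodule.mkQ_surjective _ (e z').1
  obtain ⟨v, hv⟩ := Submodule.mkQ_surjective _ (e w').1
  have hu0 : IsUnit u := by
    by_contra hnu
    have h1 : (e z').1 = 0 := by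
      rw [← hu]
      exact (Submodule.Quotient.mk_eq_zero _).mpr ((mem_maximalIdeal u).mpr hnu)
    have h2 : z' = 0 := by
      rw [← e.map_eq_zero_iff]; exact Subtype.ext h1
    exact hzJ ((Submodule.Quotient.mk_eq_zero _).mp (congrArg Subtype.val h2))
  obtain ⟨b, hb⟩ := hu0.exists_left_inv
  refine ⟨v * b, ?_⟩
  have h1 : e (w' - (v * b) • z') = 0 := by
    rw [map_sub, map_smul]
    refine Subtype.ext ?_
    rw [Submodule.coe_sub, Submodule.coe_smul, ← hu, ← hv, ← map_smul, smul_eq_mul, mul_assoc, hb,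
      mul_one, sub_self, Submodule.coe_zero]
  have h2 := congrArg Subtype.val (e.map_eq_zero_iff.mp h1)
  exact (Submodule.Quotient.mk_eq_zero _).mp h2

end

lemma IsLocalRing.exists_pow_mem_of_le_radical {g : Fin n → R} (hg : ∀ i, g i ∈ maximalIdeal R)
    {q : Ideal R} (hrad : maximalIdeal R ≤ q.radical) : ∃ N : ℕ, ∀ i, g i ^ (N + 1) ∈ q := by
  obtain ⟨N, hN⟩ := Ideal.exists_pow_le_of_le_radical_of_fg hrad
    (maximalIdeal R).fg_of_isNoetherianRing
  exact ⟨N, fun i ↦ hN (Ideal.pow_le_pow_right N.le_succ (Ideal.pow_mem_pow (hg i) _))⟩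

/-- The determinant of a matrix that expresses generators of an `𝔪`-primary ideal through a regular
sequence generating `𝔪` lies outside that ideal. -/
lemma IsLocalRing.det_notMem_span {g : Fin n → R} (hg : IsWeaklyRegular R (List.ofFn g))
    (hgm : Ideal.span (Set.range g) = maximalIdeal R) (A : Matrix (Fin n) (Fin n) R)
    (hrad : maximalIdeal R ≤ (Ideal.span (Set.range (A *ᵥ g))).radical) :
    A.det ∉ Ideal.span (Set.range (A *ᵥ g)) := by
  have hgm' : ∀ i, g i ∈ maximalIdeal R := fun i ↦ hgm ▸ Ideal.subset_span ⟨i, rfl⟩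
  obtain ⟨N, hN⟩ := exists_pow_mem_of_le_radical hgm' hrad
  exact A.det_notMem_span_range_mulVec (hgm ▸ (maximalIdeal.isMaximal R).ne_top)
    (fun e he i _ ↦ hg.mem_span_pow_of_mul_mem hgm' e he i) hN

/-- If an `𝔪`-primary ideal with generators `Wᵀ g` is also generated by `n` elements, then some
maximal minor of `W` lies outside it. -/
lemma IsLocalRing.exists_minor_notMem {r : ℕ} {g : Fin n → R}
    (hg : IsWeaklyRegular R (List.ofFn g)) (hgm : Ideal.span (Set.range g) = maximalIdeal R)
    {W : Matrix (Fin n) (Fin r) R}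
    (hrad : maximalIdeal R ≤ (Ideal.span (Set.range (Wᵀ *ᵥ g))).radical) {h : Fin n → R}
    (hh : Ideal.span (Set.range h) = Ideal.span (Set.range (Wᵀ *ᵥ g))) :
    ∃ c : Fin n ↪o Fin r, (W.submatrix id c).det ∉ Ideal.span (Set.range (Wᵀ *ᵥ g)) := by
  by_contra! H
  have : ∀ i, ∃ b : Fin r → R, ∑ j, b j * (Wᵀ *ᵥ g) j = h i := fun i ↦
    Ideal.mem_span_range_iff_exists_fun.mp (hh ▸ Ideal.subset_span ⟨i, rfl⟩)
  choose B hB using this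
  have hBh : (Matrix.of B * Wᵀ) *ᵥ g = h := by
    rw [← mulVec_mulVec]; exact funext hB
  have h1 := det_notMem_span hg hgm (Matrix.of B * Wᵀ) (by rwa [hBh, hh])
  rw [hBh, hh] at h1
  exact h1 (det_mul_transpose_mem H _)

/-- If `A` expresses elements of an `𝔪`-primary ideal `q` through `g` and `det A` is not in `q`,
then `q` is generated by a regular sequence of length `n`. -/
lemma IsLocalRing.exists_isWeaklyRegular_span_eq {g : Fin n → R}
    (hg : IsWeaklyRegular R (List.ofFn g)) (hgm : Ideal.span (Set.range g) = maximalIdeal R)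
    {q : Ideal R} (hqm : q ≤ maximalIdeal R) (hrad : maximalIdeal R ≤ q.radical)
    {A : Matrix (Fin n) (Fin n) R} (hA : ∀ i, (A *ᵥ g) i ∈ q) (hdet : A.det ∉ q) :
    ∃ h : Fin n → R, IsWeaklyRegular R (List.ofFn h) ∧ Ideal.span (Set.range h) = q := by
  have hgl : Ideal.ofList (List.ofFn g) = maximalIdeal R := by rw [Ideal.ofList_ofFn, hgm]
  obtain ⟨h, hreg, hh⟩ := exists_isWeaklyRegular_sub_mem hg
    (fun r hr ↦ hgl.le (Ideal.subset_span hr)) (I := q * maximalIdeal R)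
    (by rw [Ideal.radical_mul]; exact le_inf hrad Ideal.le_radical) Ideal.mul_le_right
    (by simp) (A *ᵥ g) (fun i ↦ hqm (hA i))
  have : ∀ i, ∃ b : Fin n → R, (∀ j, b j ∈ q) ∧ ∑ j, b j * g j = h i - (A *ᵥ g) i := fun i ↦ by
    have := hh i
    rw [← hgm, ← smul_eq_mul, Ideal.span, Submodule.mem_ideal_smul_span_iff_exists_sum] at this
    obtain ⟨b, hb, hsum⟩ := this
    rw [Finsupp.sum_fintype _ _ (by simp)] at hsum
    exact ⟨b, hb, hsum⟩
  choose B hBq hB using this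
  have hABg : (A + Matrix.of B) *ᵥ g = h := by
    ext i
    rw [add_mulVec, Pi.add_apply, ← eq_sub_iff_add_eq']
    exact hB i
  have hdet' : (A + Matrix.of B).det ∉ q := by
    rw [← Ideal.Quotient.eq_zero_iff_mem, RingHom.map_det] at hdet ⊢
    convert hdet using 3
    ext i j
    simpa using Ideal.Quotient.eq_zero_iff_mem.mpr (hBq i j)
  have hJq : Ideal.ofList (List.ofFn h) ≤ q := by
    rw [Ideal.ofList_ofFn, Ideal.span_le]
    rintro _ ⟨i, rfl⟩
    exact (Submodule.sub_mem_iff_left _ (hA i)).mp (Ideal.mul_le_left (hh i))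
  refine ⟨h, hreg, ?_⟩
  rw [← Ideal.ofList_ofFn]
  by_contra hne
  have hJm := hJq.trans hqm
  -- The socle of `R / (h)` is spanned by `det (A + B)`, but it meets `q / (h)`.
  obtain ⟨z, hzq, hzJ, hz⟩ := exists_notMem_of_le_radical
    (le_radical_of_length_eq hg hgl hreg hJm (by simp)) (fun hle ↦ hne (le_antisymm hJq hle))
  obtain ⟨a, ha⟩ := exists_sub_mul_mem hg hgl hreg hJm (by simp) hz hzJ
    (w := (A + Matrix.of B).det) (by
      intro a ha
      rw [← hgm] at ha
      obtain ⟨c, rfl⟩ := Ideal.mem_span_range_iff_exists_fun.mp ha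
      rw [Finset.sum_mul]
      refine Ideal.sum_mem _ fun j _ ↦ ?_
      have : c j * g j * (A + Matrix.of B).det =
          c j * ((A + Matrix.of B).adjugate *ᵥ h) j := by
        rw [← hABg, mulVec_mulVec, adjugate_mul, smul_mulVec, one_mulVec, Pi.smul_apply,
          smul_eq_mul]
        ring
      rw [this]
      refine Ideal.mul_mem_left _ _ (mulVec_apply_mem _ (fun k ↦ ?_) j)
      exact Ideal.subset_span (List.mem_ofFn.mpr ⟨k, rfl⟩))
  exact hdet' ((Submodule.sub_mem_iff_left _ (Ideal.mul_mem_left _ _ hzq)).mp (hJq ha))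

end Local

/-! ### Maximal ideals of polynomial rings -/

section MaximalIdeals

lemma List.exists_ofFn_eq_of_length_eq {α : Type*} {n : ℕ} {l : List α} (h : l.length = n) :
    ∃ f : Fin n → α, List.ofFn f = l := by
  subst h
  exact ⟨l.get, List.ofFn_get l⟩

/-- Regular sequences are transported by ring isomorphisms. -/
lemma RingTheory.Sequence.IsRegular.map_ringEquiv {A B : Type*} [CommRing A] [CommRing B]
    (e : A ≃+* B) {rs : List A} (h : IsRegular A rs) : IsRegular B (rs.map e) :=
  (AddEquiv.isRegular_congr (e := e.toAddEquiv)
    (List.forall₂_map_right_iff.mpr (List.forall₂_same.mpr fun r _ x ↦ map_mul e r x))).mp h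

/-- If `p` is a maximal ideal of `A[X]` that lies over a maximal ideal generated by a regular
sequence, one further polynomial completes the sequence to one that generates `p`. -/
lemma Polynomial.exists_isRegular_ofList_eq {A : Type*} [CommRing A] [IsJacobsonRing A]
    (p : Ideal (Polynomial A)) [hp : p.IsMaximal] {gs : List A} (hgs : IsRegular A gs)
    (hgp : Ideal.ofList gs = p.comap Polynomial.C) :
    ∃ y : Polynomial A, IsRegular (Polynomial A) (gs.map Polynomial.C ++ [y]) ∧
      Ideal.ofList (gs.map Polynomial.C ++ [y]) = p := by
  have hmax : (p.comap Polynomial.C).IsMaximal := Polynomial.isMaximal_comap_C_of_isJacobsonRing p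
  have hne : p ≠ (p.comap Polynomial.C).map Polynomial.C := fun h ↦ by
    rw [h, Ideal.Quotient.maximal_ideal_iff_isField_quotient] at hp
    have := Ideal.Quotient.nontrivial_iff.mpr hmax.ne_top
    exact Polynomial.not_isField (A ⧸ p.comap Polynomial.C)
      ((Ideal.polynomialQuotientEquivQuotientPolynomial _).toMulEquiv.isField hp)
  obtain ⟨y, hy, hpy⟩ := Polynomial.exists_monic_span_sup_map_eq A p hmax hne
  have hspan : Ideal.ofList (gs.map Polynomial.C) = (p.comap Polynomial.C).map Polynomial.C := by
    rw [← Ideal.map_ofList, hgp]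
  have hall : Ideal.ofList (gs.map Polynomial.C ++ [y]) = p := by
    rw [Ideal.ofList_append, Ideal.ofList_singleton, hspan, ← hpy]
  refine ⟨y, ⟨?_, ?_⟩, hall⟩
  · rw [isWeaklyRegular_append_iff, isWeaklyRegular_singleton_iff]
    refine ⟨hgs.toIsWeaklyRegular.of_flat (S := Polynomial A), ?_⟩
    have hprime : ((p.comap Polynomial.C).map Polynomial.C).IsPrime :=
      Ideal.isPrime_map_C_of_isPrime
    rw [smul_eq_mul, Ideal.mul_top, hspan, isSMulRegular_quotient_iff_mem_of_smul_mem]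
    intro x hx
    refine (hprime.mem_or_mem hx).resolve_left fun hmem ↦ hne ?_
    exact hpy.trans (sup_eq_left.mpr ((Ideal.span_singleton_le_iff_mem _).mpr hmem))
  · rw [hall, smul_eq_mul, Ideal.mul_top]
    exact hp.ne_top.symm

variable {K : Type*} [Field K]

/-- Every maximal ideal of `K[x₁, …, xₙ]` is generated by a regular sequence of length `n`. -/
theorem MvPolynomial.exists_isRegular_span_range_eq {n : ℕ} (M : Ideal (MvPolynomial (Fin n) K))
    [hM : M.IsMaximal] : ∃ g : Fin n → MvPolynomial (Fin n) K,
      IsRegular (MvPolynomial (Fin n) K) (List.ofFn g) ∧ Ideal.span (Set.range g) = M := by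
  suffices H : ∃ gs : List (MvPolynomial (Fin n) K), gs.length = n ∧
      IsRegular (MvPolynomial (Fin n) K) gs ∧ Ideal.ofList gs = M by
    obtain ⟨gs, hlen, hreg, hgs⟩ := H
    obtain ⟨g, rfl⟩ := List.exists_ofFn_eq_of_length_eq hlen
    exact ⟨g, hreg, by rw [← Ideal.ofList_ofFn, hgs]⟩
  induction n with
  | zero =>
    refine ⟨[], rfl, .nil _ _, ?_⟩
    have e := MvPolynomial.isEmptyRingEquiv K (Fin 0)
    have hF : IsField (MvPolynomial (Fin 0) K) :=
      e.toMulEquiv.isField (Field.toIsField K)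
    let := hF.toField
    rw [Ideal.ofList_nil]
    exact ((Ideal.eq_bot_or_top M).resolve_right hM.ne_top).symm
  | succ n ih =>
    let e := (MvPolynomial.finSuccEquiv K n).toRingEquiv
    let p := M.comap e.symm
    have hp : p.IsMaximal := Ideal.comap_isMaximal_of_surjective _ e.symm.surjective
    obtain ⟨gs, hlen, hreg, hgs⟩ := ih (hM := Polynomial.isMaximal_comap_C_of_isJacobsonRing p)
      (p.comap Polynomial.C)
    obtain ⟨y, hyreg, hy⟩ := Polynomial.exists_isRegular_ofList_eq p hreg hgs
    refine ⟨(gs.map Polynomial.C ++ [y]).map e.symm, by simp [hlen],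
      hyreg.map_ringEquiv e.symm, ?_⟩
    have := Ideal.map_ofList e.symm.toRingHom
      (gs.map Polynomial.C ++ [y])
    refine this.symm.trans ?_
    rw [hy]
    exact Ideal.map_comap_of_surjective _ e.symm.surjective M

end MaximalIdeals

/-! ### Passage to the localization -/

section Localize

variable {A : Type*} [CommRing A] {M Q : Ideal A}

lemma Ideal.IsPrimary.algebraMap_mem_map_iff [M.IsPrime] (hQ : Q.IsPrimary) (hQM : Q.radical = M)
    {x : A} : algebraMap A (Localization.AtPrime M) x ∈ Q.map (algebraMap A _) ↔ x ∈ Q := by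
  have hdisj : Disjoint (M.primeCompl : Set A) (Q : Set A) :=
    Set.disjoint_left.mpr fun y hy hyQ ↦ hy (hQM ▸ Ideal.le_radical hyQ)
  have := IsLocalization.under_map_of_isPrimary_disjoint M.primeCompl (Localization.AtPrime M) hQ
    hdisj
  rw [← Ideal.mem_comap]
  exact iff_of_eq (congrArg (x ∈ ·) this)

variable [M.IsMaximal] {n r : ℕ} {g : Fin n → A} {f : Fin r → A} {W : Matrix (Fin n) (Fin r) A}

section

variable (hreg : IsRegular A (List.ofFn g)) (hg : Ideal.span (Set.range g) = M)

include hreg in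
lemma Localization.AtPrime.isWeaklyRegular_ofFn_algebraMap_comp :
    IsWeaklyRegular (Localization.AtPrime M)
      (List.ofFn (algebraMap A (Localization.AtPrime M) ∘ g)) := by
  have := hreg.toIsWeaklyRegular.of_isLocalization (Localization.AtPrime M) M.primeCompl
  rwa [List.map_ofFn] at this

include hg in
lemma Localization.AtPrime.span_range_algebraMap_comp_eq_maximalIdeal :
    Ideal.span (Set.range (algebraMap A (Localization.AtPrime M) ∘ g)) =
      maximalIdeal (Localization.AtPrime M) := by
  rw [Set.range_comp, ← Ideal.map_span, hg, Localization.AtPrime.map_eq_maximalIdeal]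

end

lemma Localization.AtPrime.maximalIdeal_le_radical_map (hQM : Q.radical = M) :
    maximalIdeal (Localization.AtPrime M) ≤
      (Q.map (algebraMap A (Localization.AtPrime M))).radical := by
  rw [← Localization.AtPrime.map_eq_maximalIdeal]
  exact (Ideal.map_mono hQM.ge).trans (Ideal.map_radical_le _)

lemma Localization.AtPrime.map_le_maximalIdeal (hQM : Q.radical = M) :
    Q.map (algebraMap A (Localization.AtPrime M)) ≤ maximalIdeal (Localization.AtPrime M) := by
  rw [← Localization.AtPrime.map_eq_maximalIdeal]
  exact Ideal.map_mono (Ideal.le_radical.trans hQM.le)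

lemma Matrix.transpose_map_mulVec_comp (hW : ∀ j, f j = ∑ k, W k j * g k) {S : Type*} [CommRing S]
    (φ : A →+* S) : (W.map φ).transpose.mulVec (φ ∘ g) = φ ∘ f := by
  ext j
  simp [Matrix.mulVec, dotProduct, hW]

variable [IsNoetherianRing A]

/-- If `Q` generates an ideal of the localization that is generated by a regular sequence, then some
maximal minor of `W` lies outside `Q`. -/
lemma exists_minor_notMem_of_isRegular (hreg : IsRegular A (List.ofFn g))
    (hg : Ideal.span (Set.range g) = M) (hQM : Q.radical = M)
    (hf : Ideal.span (Set.range f) = Q) (hW : ∀ j, f j = ∑ k, W k j * g k)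
    {hs : List (Localization.AtPrime M)} (hhs : IsRegular (Localization.AtPrime M) hs)
    (hsQ : Ideal.ofList hs = Q.map (algebraMap A (Localization.AtPrime M))) :
    ∃ c : Fin n ↪o Fin r, (W.submatrix id c).det ∉ Q := by
  have hreg' := Localization.AtPrime.isWeaklyRegular_ofFn_algebraMap_comp (M := M) hreg
  have hg' := Localization.AtPrime.span_range_algebraMap_comp_eq_maximalIdeal hg
  have hspan : Ideal.span (Set.range ((W.map
      (algebraMap A (Localization.AtPrime M))).transpose.mulVec
        (algebraMap A (Localization.AtPrime M) ∘ g))) =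
        Q.map (algebraMap A (Localization.AtPrime M)) := by
    rw [Matrix.transpose_map_mulVec_comp hW, Set.range_comp, ← Ideal.map_span, hf]
  have hlen := length_eq_of_le_radical hreg' (by rw [Ideal.ofList_ofFn, hg'])
    hhs.toIsWeaklyRegular (hsQ ▸ Localization.AtPrime.map_le_maximalIdeal hQM)
    (hsQ ▸ Localization.AtPrime.maximalIdeal_le_radical_map hQM)
  rw [List.length_ofFn] at hlen
  obtain ⟨h, rfl⟩ := List.exists_ofFn_eq_of_length_eq hlen
  rw [Ideal.ofList_ofFn, ← hspan] at hsQ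
  obtain ⟨c, hc⟩ := exists_minor_notMem hreg' hg'
    (hspan ▸ Localization.AtPrime.maximalIdeal_le_radical_map hQM) hsQ
  refine ⟨c, fun hmem ↦ hc ?_⟩
  rw [hspan, Matrix.submatrix_map, ← RingHom.mapMatrix_apply, ← RingHom.map_det]
  exact Ideal.mem_map_of_mem _ hmem

/-- If some maximal minor of `W` lies outside `Q`, then `Q` generates an ideal of the localization
that is generated by a regular sequence of length `n`. -/
lemma exists_isRegular_of_minor_notMem (hreg : IsRegular A (List.ofFn g))
    (hg : Ideal.span (Set.range g) = M) (hQ : Q.IsPrimary) (hQM : Q.radical = M)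
    (hf : Ideal.span (Set.range f) = Q) (hW : ∀ j, f j = ∑ k, W k j * g k)
    {c : Fin n ↪o Fin r} (hc : (W.submatrix id c).det ∉ Q) :
    ∃ hs : List (Localization.AtPrime M), hs.length = n ∧ IsRegular (Localization.AtPrime M) hs ∧
      Ideal.ofList hs = Q.map (algebraMap A (Localization.AtPrime M)) := by
  have hg' := Localization.AtPrime.span_range_algebraMap_comp_eq_maximalIdeal hg
  obtain ⟨h, hh, hspan⟩ := exists_isWeaklyRegular_span_eq
    (Localization.AtPrime.isWeaklyRegular_ofFn_algebraMap_comp hreg) hg'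
    (Localization.AtPrime.map_le_maximalIdeal hQM)
    (Localization.AtPrime.maximalIdeal_le_radical_map hQM)
    (A := ((W.submatrix id c).map (algebraMap A (Localization.AtPrime M))).transpose)
    (by
      intro i
      rw [Matrix.transpose_map_mulVec_comp (f := f ∘ c) (W := W.submatrix id c) (fun j ↦ hW (c j))]
      exact Ideal.mem_map_of_mem _ (hf ▸ Ideal.subset_span ⟨_, rfl⟩))
    (by
      rw [Matrix.det_transpose, ← RingHom.mapMatrix_apply, ← RingHom.map_det,
        hQ.algebraMap_mem_map_iff hQM]
      exact hc)
  have hspan' : Ideal.ofList (List.ofFn h) = Q.map (algebraMap A (Localization.AtPrime M)) := by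
    rw [Ideal.ofList_ofFn, hspan]
  refine ⟨List.ofFn h, List.length_ofFn, ?_, hspan'⟩
  exact .of_isWeaklyRegular_of_mem_maximalIdeal _
    (fun x hx ↦ Localization.AtPrime.map_le_maximalIdeal hQM (hspan'.le (Ideal.subset_span hx))) hh

end Localize

section Kernel

variable {A : Type*} [CommRing A] {I Q : Ideal A}

/-- If `I` and `Q` agree after inverting an element `t` outside of the radical of the primary ideal
`Q`, then `Q` generates the kernel of `A_M → (A / I)_m`, where `M` is the radical of `Q`. -/
lemma ker_localRingHom_quotient_eq_map (hQ : Q.IsPrimary) (hIQ : I ≤ Q) (m : Ideal (A ⧸ I))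
    [m.IsPrime] (hm : Q.radical = m.comap (Ideal.Quotient.mk I)) {t : A} (ht : t ∉ Q.radical)
    (htQ : ∀ a ∈ Q, t * a ∈ I) :
    RingHom.ker (Localization.localRingHom (m.comap (Ideal.Quotient.mk I)) m
      (Ideal.Quotient.mk I) rfl) =
      Q.map (algebraMap A (Localization.AtPrime (m.comap (Ideal.Quotient.mk I)))) := by
  ext x
  obtain ⟨a, s, rfl⟩ :=
    IsLocalization.exists_mk'_eq (m.comap (Ideal.Quotient.mk I)).primeCompl x
  rw [RingHom.mem_ker, Localization.localRingHom_mk', IsLocalization.mk'_eq_zero_iff,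
    IsLocalization.mk'_mem_iff, hQ.algebraMap_mem_map_iff hm]
  constructor
  · rintro ⟨⟨u, hu⟩, hua⟩
    obtain ⟨u, rfl⟩ := Ideal.Quotient.mk_surjective u
    rw [← map_mul, Ideal.Quotient.eq_zero_iff_mem] at hua
    refine ((Ideal.isPrimary_iff.mp hQ).2 (mul_comm u a ▸ hIQ hua)).resolve_right fun hur ↦ hu ?_
    rw [hm] at hur
    exact hur
  · intro ha
    refine ⟨⟨Ideal.Quotient.mk I t, fun h ↦ ht ?_⟩, ?_⟩
    · rw [hm]; exact h
    · rw [← map_mul, Ideal.Quotient.eq_zero_iff_mem]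
      exact htQ a ha

end Kernel

/-! ### Zero-dimensional schemes -/

section Scheme

variable {A : Type*} [CommRing A] {I : Ideal A} {t : Finset (Ideal A)}

lemma Submodule.IsMinimalPrimaryDecomposition.le_of_mem (ht : IsMinimalPrimaryDecomposition I t)
    {Q : Ideal A} (hQ : Q ∈ t) : I ≤ Q :=
  ht.inf_eq.symm.le.trans (Finset.inf_le hQ)

lemma isMaximal_of_le_of_isArtinianRing_quotient [IsArtinianRing (A ⧸ I)] {p : Ideal A}
    [hp : p.IsPrime] (hIp : I ≤ p) : p.IsMaximal := by
  have hker : RingHom.ker (Ideal.Quotient.mk I) ≤ p := by rwa [Ideal.mk_ker]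
  have := Ideal.map_isPrime_of_surjective Ideal.Quotient.mk_surjective hker
  rw [← Ideal.comap_map_mk hIp]
  exact Ideal.comap_isMaximal_of_surjective _ Ideal.Quotient.mk_surjective

/-- An element of the other primary components that lies outside a given maximal component
separates this component from `I`. -/
lemma Submodule.IsMinimalPrimaryDecomposition.exists_notMem_radical
    (ht : IsMinimalPrimaryDecomposition I t) (hmax : ∀ Q ∈ t, Q.radical.IsMaximal)
    {Q : Ideal A} (hQ : Q ∈ t) : ∃ s ∉ Q.radical, ∀ a ∈ Q, s * a ∈ I := by
  classical
  have hnot : ¬ (t.erase Q).inf id ≤ Q.radical := by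
    rw [(hmax Q hQ).isPrime.inf_le']
    rintro ⟨Q', hQ', hle⟩
    have hrad : Q'.radical = Q.radical :=
      (hmax Q' (Finset.mem_of_mem_erase hQ')).eq_of_le (hmax Q hQ).ne_top
        ((hmax Q hQ).isPrime.radical_le_iff.mpr hle)
    exact ht.distinct (Finset.mem_of_mem_erase hQ') hQ (Finset.ne_of_mem_erase hQ')
      (by simpa using hrad)
  obtain ⟨s, hs, hsQ⟩ := SetLike.not_le_iff_exists.mp hnot
  refine ⟨s, hsQ, fun a ha ↦ ?_⟩
  rw [← ht.inf_eq, Submodule.mem_finsetInf]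
  intro Q' hQ'
  by_cases h : Q' = Q
  · exact h ▸ Ideal.mul_mem_left _ _ ha
  · exact Ideal.mul_mem_right _ _
      ((Finset.inf_le (Finset.mem_erase.mpr ⟨h, hQ'⟩) : (t.erase Q).inf id ≤ id Q') hs)

variable {K : Type*} [Field K] {n : ℕ}

/-- Being locally a complete intersection is checked on the components of a primary decomposition,
one maximal ideal at a time. -/
lemma isLocallyCompleteIntersection_iff {I : Ideal (MvPolynomial (Fin n) K)}
    {t : Finset (Ideal (MvPolynomial (Fin n) K))} (ht : IsMinimalPrimaryDecomposition I t)
    (hmax : ∀ Q ∈ t, Q.radical.IsMaximal) {C : t → Prop}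
    (hC : ∀ (Q : t) (M : Ideal (MvPolynomial (Fin n) K)) [M.IsMaximal], Q.1.radical = M →
      (IsCompleteIntersectionQuotient M (Q.1.map (algebraMap _ (Localization.AtPrime M))) ↔ C Q)) :
    IsLocallyCompleteIntersection I ↔ ∀ Q, C Q := by
  have key (Q : t) (m : Ideal (MvPolynomial (Fin n) K ⧸ I)) [m.IsMaximal]
      (hm : Q.1.radical = m.comap (Ideal.Quotient.mk I)) : IsCompleteIntersectionAt I m ↔ C Q := by
    obtain ⟨s, hs, hsQ⟩ := ht.exists_notMem_radical hmax Q.2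
    have : (m.comap (Ideal.Quotient.mk I)).IsMaximal := hm ▸ hmax _ Q.2
    rw [← hC Q _ hm, IsCompleteIntersectionAt,
      ker_localRingHom_quotient_eq_map (ht.primary Q.2) (ht.le_of_mem Q.2) m hm hs hsQ]
  constructor
  · intro h Q
    have hQ := hmax _ Q.2
    have hIQ : I ≤ Q.1.radical := (ht.le_of_mem Q.2).trans Ideal.le_radical
    have hmm : (Q.1.radical.map (Ideal.Quotient.mk I)).IsMaximal :=
      Ideal.IsMaximal.map_of_surjective_of_ker_le Ideal.Quotient.mk_surjective
        (by rwa [Ideal.mk_ker])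
    exact (key Q _ (Ideal.comap_map_mk hIQ).symm).mp (h _)
  · intro h m _
    have hmm : (m.comap (Ideal.Quotient.mk I)).IsMaximal :=
      Ideal.comap_isMaximal_of_surjective _ Ideal.Quotient.mk_surjective
    have hle : t.inf id ≤ m.comap (Ideal.Quotient.mk I) := by
      rw [ht.inf_eq]
      intro x hx
      rw [Ideal.mem_comap, Ideal.Quotient.eq_zero_iff_mem.mpr hx]
      exact m.zero_mem
    obtain ⟨Q, hQ, hQm⟩ := hmm.isPrime.inf_le'.mp hle
    exact (key ⟨Q, hQ⟩ m ((hmax Q hQ).eq_of_le hmm.ne_top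
      (hmm.isPrime.radical_le_iff.mpr hQm))).mpr (h _)

end Scheme

end Auxiliary

/-! ### The complete intersection check -/

theorem mainTheorem2 {K : Type*} [Field K] (n : ℕ) :
    -- the check at one maximal ideal
    (∀ (M : Ideal (MvPolynomial (Fin n) K)) [M.IsMaximal]
        (g : Fin n → MvPolynomial (Fin n) K),
        RingTheory.Sequence.IsRegular (MvPolynomial (Fin n) K) (List.ofFn g) →
        Ideal.span (Set.range g) = M →
      ∀ Q : Ideal (MvPolynomial (Fin n) K), Q.IsPrimary → Q.radical = M →
      ∀ (r : ℕ) (f : Fin r → MvPolynomial (Fin n) K), Ideal.span (Set.range f) = Q →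
        (∃ W, IsCoefficientMatrix g f W) ∧
        ∀ W, IsCoefficientMatrix g f W →
          ((Q.map (algebraMap _ (Localization.AtPrime M))).GeneratedByRegularSequence ↔
            CheckReturnsTrue Q W) ∧
          (IsCompleteIntersectionQuotient M (Q.map (algebraMap _ (Localization.AtPrime M))) ↔
            CheckReturnsTrue Q W)) ∧
    -- the check for a zero-dimensional scheme
    (∀ I : Ideal (MvPolynomial (Fin n) K), Module.Finite K (MvPolynomial (Fin n) K ⧸ I) →
      (∃ t : Finset (Ideal (MvPolynomial (Fin n) K)),
        Submodule.IsMinimalPrimaryDecomposition I t) ∧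
      ∀ t : Finset (Ideal (MvPolynomial (Fin n) K)),
        Submodule.IsMinimalPrimaryDecomposition I t →
        (∀ Q ∈ t, Q.radical.IsMaximal ∧
          (∃ g : Fin n → MvPolynomial (Fin n) K,
            RingTheory.Sequence.IsRegular (MvPolynomial (Fin n) K) (List.ofFn g) ∧
            Ideal.span (Set.range g) = Q.radical) ∧
          ∃ (r : ℕ) (f : Fin r → MvPolynomial (Fin n) K), Ideal.span (Set.range f) = Q) ∧
        ∀ (g : t → Fin n → MvPolynomial (Fin n) K),
          (∀ Q : t,
            RingTheory.Sequence.IsRegular (MvPolynomial (Fin n) K) (List.ofFn (g Q)) ∧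
            Ideal.span (Set.range (g Q)) = Q.1.radical) →
        ∀ (r : t → ℕ) (f : (Q : t) → Fin (r Q) → MvPolynomial (Fin n) K),
          (∀ Q : t, Ideal.span (Set.range (f Q)) = Q.1) →
        ∀ W : (Q : t) → Matrix (Fin n) (Fin (r Q)) (MvPolynomial (Fin n) K),
          (∀ Q : t, IsCoefficientMatrix (g Q) (f Q) (W Q)) →
          (IsLocallyCompleteIntersection I ↔ ∀ Q : t, CheckReturnsTrue Q.1 (W Q))) := by
  have check : ∀ (M : Ideal (MvPolynomial (Fin n) K)) [M.IsMaximal]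
      (g : Fin n → MvPolynomial (Fin n) K),
      RingTheory.Sequence.IsRegular (MvPolynomial (Fin n) K) (List.ofFn g) →
      Ideal.span (Set.range g) = M → ∀ Q : Ideal (MvPolynomial (Fin n) K), Q.IsPrimary →
      Q.radical = M → ∀ (r : ℕ) (f : Fin r → MvPolynomial (Fin n) K),
      Ideal.span (Set.range f) = Q → ∀ W, IsCoefficientMatrix g f W →
        ((Q.map (algebraMap _ (Localization.AtPrime M))).GeneratedByRegularSequence ↔
          CheckReturnsTrue Q W) ∧
        (IsCompleteIntersectionQuotient M (Q.map (algebraMap _ (Localization.AtPrime M))) ↔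
          CheckReturnsTrue Q W) := by
    intro M _ g hreg hg Q hQ hQM r f hf W hW
    have h1 : (Q.map (algebraMap _ (Localization.AtPrime M))).GeneratedByRegularSequence →
        CheckReturnsTrue Q W := by
      rintro ⟨hs, hhs, hsQ⟩
      obtain ⟨c, hc⟩ := exists_minor_notMem_of_isRegular hreg hg hQM hf hW hhs hsQ
      exact ⟨c, fun h ↦ hc (Ideal.Quotient.eq_zero_iff_mem.mp h)⟩
    have h2 : CheckReturnsTrue Q W →
        IsCompleteIntersectionQuotient M (Q.map (algebraMap _ (Localization.AtPrime M))) := by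
      rintro ⟨c, hc⟩
      exact exists_isRegular_of_minor_notMem hreg hg hQ hQM hf hW
        fun h ↦ hc (Ideal.Quotient.eq_zero_iff_mem.mpr h)
    have h3 : IsCompleteIntersectionQuotient M (Q.map (algebraMap _ (Localization.AtPrime M))) →
        (Q.map (algebraMap _ (Localization.AtPrime M))).GeneratedByRegularSequence :=
      fun ⟨hs, _, hhs, hsQ⟩ ↦ ⟨hs, hhs, hsQ⟩
    exact ⟨⟨h1, h3 ∘ h2⟩, ⟨h1 ∘ h3, h2⟩⟩
  refine ⟨fun M _ g hreg hg Q hQ hQM r f hf ↦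
    ⟨?_, check M g hreg hg Q hQ hQM r f hf⟩, fun I hI ↦ ⟨?_, fun t ht ↦ ?_⟩⟩
  · have : ∀ j, ∃ w : Fin n → MvPolynomial (Fin n) K, ∑ k, w k * g k = f j := fun j ↦ by
      rw [← Ideal.mem_span_range_iff_exists_fun, hg, ← hQM, ← hf]
      exact Ideal.le_radical (Ideal.subset_span ⟨j, rfl⟩)
    choose w hw using this
    exact ⟨Matrix.of fun k j ↦ w j k, fun j ↦ (hw j).symm⟩
  · exact Submodule.IsLasker.exists_isMinimalPrimaryDecomposition (Submodule.isLasker _ _) I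
  · have : IsArtinianRing (MvPolynomial (Fin n) K ⧸ I) := IsArtinianRing.of_finite K _
    have hmax : ∀ Q ∈ t, Q.radical.IsMaximal := fun Q hQ ↦
      have := Ideal.isPrime_radical (ht.primary hQ)
      isMaximal_of_le_of_isArtinianRing_quotient ((ht.le_of_mem hQ).trans Ideal.le_radical)
    refine ⟨fun Q hQ ↦ ⟨hmax Q hQ, ?_, ?_⟩, fun g hg r f hf W hW ↦ ?_⟩
    · have := hmax Q hQ
      exact MvPolynomial.exists_isRegular_span_range_eq Q.radical
    · exact (Submodule.fg_iff_exists_fin_generating_family).mp (IsNoetherian.noetherian Q)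
    · refine isLocallyCompleteIntersection_iff ht hmax fun Q M _ hQM ↦ ?_
      exact (check M (g Q) (hg Q).1 ((hg Q).2.trans hQM) Q.1 (ht.primary Q.2) hQM (r Q) (f Q)
        (hf Q) (W Q) (hW Q)).2
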